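/- All graphs are simple. For a graph $\Gamma$ with vertex set $V(\Gamma)$ and edge set $E(\Gamma)$, let $A(\Gamma)=\langle V(\Gamma)\mid uvu^{-1}v^{-1}=1 \text{ if } \{u,v\}\in E(\Gamma)\rangle$ be the right-angled Artin group on $\Gamma$. A word in the letters $V(\Gamma)\cup V(\Gamma)^{-1}$ is reduced if no shorter word represents the same element of $A(\Gamma)$. The support $\mathrm{supp}(g)\subset V(\Gamma)$ of $g\in A(\Gamma)$ is the set of vertices $v$ such that $v$ or $v^{-1}$ occurs in a reduced word representing $g$ (it does not depend on the choice of the reduced word). For a homomorphism $\psi\colon A(\Lambda)\to A(\Gamma)$ put $\mathrm{supp}(\psi)=\bigcup_{v\in V(\Lambda)}\mathrm{supp}(\psi(v))$; we say that $\psi$ satisfies the (KK) condition if, for every $v\in V(\Lambda)$, the vertices in $\mathrm{supp}(\psi(v))$ are mutually adjacent in $\Gamma$. A full embedding $\Lambda\to\Gamma$ is an injective map $V(\Lambda)\to V(\Gamma)$ that maps adjacent vertices to adjacent vertices and non-adjacent vertices to non-adjacent vertices. The join $\Lambda_1*\cdots*\Lambda_m$ is the graph obtained from the disjoint union $\Lambda_1\sqcup\cdots\sqcup\Lambda_m$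 by joining every vertex of $\Lambda_i$ to every vertex of $\Lambda_j$ for all $i\neq j$. A graph is irreducible if it is not the join of two non-empty graphs. **Proposition.** Let $\Lambda=\Lambda_1*\cdots*\Lambda_m$ be the join of finite irreducible graphs $\Lambda_1,\dots,\Lambda_m$, and let $\Gamma$ be a finite graph. Let $\psi\colon A(\Lambda)\to A(\Gamma)$ be an injective homomorphism satisfying the (KK) condition. Suppose that for each $1\le i\le m$ there is a full embedding $\iota_i\colon\Lambda_i\to\Gamma$ with $\iota_i(V(\Lambda_i))\subset\mathrm{supp}(\psi_i)$, where $\psi_i$ is the restriction of $\psi$ to $A(\Lambda_i)$. Then there is a full embedding $\iota\colon\Lambda\to\Gamma$ with $\iota(V(\Lambda))\subset\mathrm{supp}(\psi)$. -/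

import Mathlib

universe u v

/-- The defining relators `a b a⁻¹ b⁻¹` (for adjacent `a`, `b`) of the right-angled Artin group. -/
def raagRels {V : Type u} (Γ : SimpleGraph V) : Set (FreeGroup V) :=
  {r | ∃ a b : V, Γ.Adj a b ∧
    r = FreeGroup.of a * FreeGroup.of b * (FreeGroup.of a)⁻¹ * (FreeGroup.of b)⁻¹}

/-- The right-angled Artin group `A(Γ)`: generated by the vertices of `Γ`, where two generators
commute whenever they are adjacent. -/
abbrev RAAG {V : Type u} (Γ : SimpleGraph V) : Type u :=
  PresentedGroup (raagRels Γ)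

namespace RAAG

/-- The generator of `A(Γ)` given by a vertex. -/
def of {V : Type u} (Γ : SimpleGraph V) (a : V) : RAAG Γ :=
  PresentedGroup.of a

theorem of_comm {V : Type u} (Γ : SimpleGraph V) {a b : V} (h : Γ.Adj a b) :
    of Γ a * of Γ b = of Γ b * of Γ a := by
  have h1 : PresentedGroup.mk (raagRels Γ)
      (FreeGroup.of a * FreeGroup.of b * (FreeGroup.of a)⁻¹ * (FreeGroup.of b)⁻¹) = 1 :=
    PresentedGroup.one_of_mem ⟨a, b, h, rfl⟩
  have h2 : of Γ a * of Γ b * (of Γ a)⁻¹ * (of Γ b)⁻¹ = 1 := by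
    simp only [map_mul, map_inv] at h1
    exact h1
  rwa [mul_inv_eq_one, mul_inv_eq_iff_eq_mul] at h2

/-- The universal property of `A(Γ)`. -/
def lift {V : Type u} (Γ : SimpleGraph V) {G : Type v} [Group G] (f : V → G)
    (hf : ∀ a b, Γ.Adj a b → f a * f b = f b * f a) : RAAG Γ →* G :=
  PresentedGroup.toGroup (f := f) (by
    rintro r ⟨a, b, hab, rfl⟩
    simp [hf a b hab])

@[simp]
theorem lift_of {V : Type u} (Γ : SimpleGraph V) {G : Type v} [Group G] (f : V → G)
    (hf : ∀ a b, Γ.Adj a b → f a * f b = f b * f a) (a : V) : lift Γ f hf (of Γ a) = f a :=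
  PresentedGroup.toGroup.of _

/-- The homomorphism of right-angled Artin groups induced by a graph homomorphism. -/
def map {V : Type u} {W : Type v} {Λ : SimpleGraph V} {Γ : SimpleGraph W} (f : Λ →g Γ) :
    RAAG Λ →* RAAG Γ :=
  lift Λ (fun a => of Γ (f a)) (fun _ _ h => of_comm Γ (f.map_adj h))

/-- The element of `A(Γ)` represented by a word. A letter `(a, true)` stands for the vertex `a`,
a letter `(a, false)` for its inverse. -/
def wordEval {V : Type u} (Γ : SimpleGraph V) (w : List (V × Bool)) : RAAG Γ :=
  (w.map fun l => cond l.2 (of Γ l.1) (of Γ l.1)⁻¹).prod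

/-- A word is reduced if every word representing the same element is at least as long. -/
def IsReducedWord {V : Type u} (Γ : SimpleGraph V) (w : List (V × Bool)) : Prop :=
  ∀ w' : List (V × Bool), wordEval Γ w' = wordEval Γ w → w.length ≤ w'.length

/-- The support of an element `g` of `A(Γ)`: the set of vertices `a` such that `a` or `a⁻¹` is a
letter of a reduced word representing `g`. By `support_wordEval` below, any one reduced word
representing `g` gives all of this set. -/
def support {V : Type u} (Γ : SimpleGraph V) (g : RAAG Γ) : Set V :=
  {a | ∃ w : List (V × Bool), IsReducedWord Γ w ∧ wordEval Γ w = g ∧ ∃ l ∈ w, l.1 = a}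

open Classical in
/-- The support can be read off from any reduced word. -/
theorem support_wordEval {V : Type u} (Γ : SimpleGraph V) (w : List (V × Bool))
    (hw : IsReducedWord Γ w) : support Γ (wordEval Γ w) = {a | ∃ l ∈ w, l.1 = a} := by
  ext a
  refine ⟨?_, fun h => ⟨w, hw, rfl, h⟩⟩
  rintro ⟨w', hw', he, l, hl, rfl⟩
  by_contra hn
  have hcomm : ∀ b c, Γ.Adj b c →
      (if b = l.1 then 1 else of Γ b) * (if c = l.1 then 1 else of Γ c) =
        (if c = l.1 then 1 else of Γ c) * (if b = l.1 then 1 else of Γ b) := by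
    intro b c h
    split_ifs <;> simp [of_comm Γ h]
  have key : ∀ x : List (V × Bool),
      lift Γ (fun b => if b = l.1 then 1 else of Γ b) hcomm (wordEval Γ x) =
        wordEval Γ (x.filter fun k => k.1 ≠ l.1) := by
    intro x
    induction x with
    | nil => simp [wordEval]
    | cons k x ih =>
      obtain ⟨b, e⟩ := k
      have hc : wordEval Γ ((b, e) :: x) = cond e (of Γ b) (of Γ b)⁻¹ * wordEval Γ x := by
        simp [wordEval]
      rw [hc, map_mul, ih]
      by_cases hb : b = l.1
      · cases e <;> simp [hb]
      · cases e <;> simp [hb, wordEval]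
  have hfw : w.filter (fun k => k.1 ≠ l.1) = w := by
    rw [List.filter_eq_self]
    intro k hk
    simpa using fun h => hn ⟨k, hk, h⟩
  have h1 : wordEval Γ (w'.filter fun k => k.1 ≠ l.1) = wordEval Γ w' := by
    rw [← key, he, key, hfw]
  have h2 := hw' _ h1
  have h3 := List.length_filter_lt_length_iff_exists (l := w') (p := fun k => k.1 ≠ l.1)
  exact absurd (h3.2 ⟨l, hl, by simp⟩) (not_lt.2 h2)

/-- The support of a homomorphism `ψ : A(Λ) → A(Γ)`: the union of the supports of the images of
the vertices of `Λ`. -/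
def homSupport {V : Type u} {W : Type v} {Λ : SimpleGraph V} {Γ : SimpleGraph W}
    (ψ : RAAG Λ →* RAAG Γ) : Set W :=
  ⋃ a : V, support Γ (ψ (of Λ a))

/-- The (KK) condition: the image of every vertex of `Λ` has a support that consists of mutually
adjacent vertices. -/
def KKCondition {V : Type u} {W : Type v} {Λ : SimpleGraph V} {Γ : SimpleGraph W}
    (ψ : RAAG Λ →* RAAG Γ) : Prop :=
  ∀ a : V, Γ.IsClique (support Γ (ψ (of Λ a)))

end RAAG

/-- The join of a family of graphs: the disjoint union of the graphs, together with all edges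
between vertices of different members of the family. -/
def graphJoin {ι : Type v} {V : ι → Type u} (Λ : ∀ i, SimpleGraph (V i)) :
    SimpleGraph (Σ i, V i) where
  Adj x y := x.1 ≠ y.1 ∨ ∃ (i : ι) (a b : V i), (Λ i).Adj a b ∧ x = ⟨i, a⟩ ∧ y = ⟨i, b⟩
  symm := ⟨by
    rintro x y (h | ⟨i, a, b, h, rfl, rfl⟩)
    · exact Or.inl h.symm
    · exact Or.inr ⟨i, b, a, h.symm, rfl, rfl⟩⟩
  loopless := ⟨by
    rintro x (h | ⟨i, a, b, h, rfl, h'⟩)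
    · exact h rfl
    · cases h'
      exact (Λ i).irrefl h⟩

/-- The inclusion of a member of the family into the join, as a full embedding. -/
def graphJoinIncl {ι : Type v} {V : ι → Type u} (Λ : ∀ i, SimpleGraph (V i)) (i : ι) :
    Λ i ↪g graphJoin Λ where
  toFun a := ⟨i, a⟩
  inj' := sigma_mk_injective
  map_rel_iff' := by
    intro a b
    constructor
    · rintro (h | ⟨j, c, d, h, h1, h2⟩)
      · exact absurd rfl h
      · cases h1
        cases h2
        exact h
    · exact fun h => Or.inr ⟨i, a, b, h, rfl, rfl⟩

/-- A graph is irreducible (with respect to join) if it is not the join of two non-empty graphs. -/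
def IsJoinIrreducible {V : Type u} (Λ : SimpleGraph V) : Prop :=
  ¬ ∃ (W : Fin 2 → Type u) (G : ∀ i, SimpleGraph (W i)),
    (∀ i, Nonempty (W i)) ∧ Nonempty (Λ ≃g graphJoin G)

/-! Vertices of different factors commute, hence so do their images. A representation in `SL(2, ℤ)`
shows that when clique-supported elements commute, their supports are pairwise equal or adjacent
(`eq_or_adj_of_commute`). Let `C` be the set of cone vertices of the subgraph induced on supp(ψ); it
is a clique. It contains every vertex shared by the supports of two factors, and the whole support
of each one-vertex factor.

A factor with at least two vertices has no cone vertex, so its embedding `ι i` avoids `C`; hence the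
images of two such factors are disjoint and completely joined. The given embeddings of one-vertex
factors may collide and are discarded: exponent sums and injectivity of ψ bound the number of these
factors by the size of `C` (`card_le_of_support_subset_clique`), so they can be sent injectively
into `C`, which is joined to everything else. -/

namespace RAAG

open Classical in
/-- The exponent sum of a vertex, as a homomorphism to the infinite cyclic group. -/
noncomputable def expSum {V : Type u} (Γ : SimpleGraph V) (a : V) :
    RAAG Γ →* Multiplicative ℤ :=
  lift Γ (fun b => if b = a then Multiplicative.ofAdd 1 else 1) (fun _ _ _ => mul_comm _ _)

theorem expSum_of_self {V : Type u} (Γ : SimpleGraph V) (a : V) :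
    expSum Γ a (of Γ a) = Multiplicative.ofAdd 1 := by
  simp [expSum]

theorem expSum_of_ne {V : Type u} (Γ : SimpleGraph V) {a b : V} (h : b ≠ a) :
    expSum Γ a (of Γ b) = 1 := by
  simp [expSum, h]

/-! ### Words and supports -/

theorem wordEval_nil {V : Type u} (Γ : SimpleGraph V) : wordEval Γ [] = 1 := by
  simp [wordEval]

theorem wordEval_cons {V : Type u} (Γ : SimpleGraph V) (l : V × Bool) (w : List (V × Bool)) :
    wordEval Γ (l :: w) = cond l.2 (of Γ l.1) (of Γ l.1)⁻¹ * wordEval Γ w := by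
  simp [wordEval]

theorem wordEval_append {V : Type u} (Γ : SimpleGraph V) (w w' : List (V × Bool)) :
    wordEval Γ (w ++ w') = wordEval Γ w * wordEval Γ w' := by
  simp [wordEval]

theorem exists_wordEval_inv {V : Type u} (Γ : SimpleGraph V) (w : List (V × Bool)) :
    ∃ w', wordEval Γ w' = (wordEval Γ w)⁻¹ ∧ ∀ l ∈ w', ∃ k ∈ w, k.1 = l.1 := by
  induction w with
  | nil => exact ⟨[], by simp [wordEval_nil], by simp⟩
  | cons k w ih =>
    obtain ⟨w', h1, h2⟩ := ih
    refine ⟨w' ++ [(k.1, !k.2)], ?_, ?_⟩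
    · rw [wordEval_append, wordEval_cons, wordEval_cons, wordEval_nil, h1]
      cases k.2 <;> simp
    · intro l hl
      rcases List.mem_append.1 hl with hl | hl
      · obtain ⟨k', hk', h⟩ := h2 l hl
        exact ⟨k', List.mem_cons_of_mem _ hk', h⟩
      · refine ⟨k, List.mem_cons_self, ?_⟩
        rw [List.mem_singleton.1 hl]

theorem exists_wordEval_eq {V : Type u} (Γ : SimpleGraph V) (g : RAAG Γ) :
    ∃ w, wordEval Γ w = g := by
  have hg : g ∈ Subgroup.closure (Set.range (PresentedGroup.of (rels := raagRels Γ))) := by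
    rw [PresentedGroup.closure_range_of]; trivial
  induction hg using Subgroup.closure_induction with
  | mem x hx =>
    obtain ⟨a, rfl⟩ := hx
    exact ⟨[(a, true)], by simp [wordEval, of]⟩
  | one => exact ⟨[], wordEval_nil Γ⟩
  | mul x y _ _ hx hy =>
    obtain ⟨w, rfl⟩ := hx
    obtain ⟨w', rfl⟩ := hy
    exact ⟨w ++ w', wordEval_append Γ w w'⟩
  | inv x _ hx =>
    obtain ⟨w, rfl⟩ := hx
    obtain ⟨w', h, -⟩ := exists_wordEval_inv Γ w
    exact ⟨w', h⟩

theorem exists_isReducedWord {V : Type u} (Γ : SimpleGraph V) (g : RAAG Γ) :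
    ∃ w, IsReducedWord Γ w ∧ wordEval Γ w = g := by
  classical
  have h : ∃ n, ∃ w, wordEval Γ w = g ∧ w.length = n := by
    obtain ⟨w, hw⟩ := exists_wordEval_eq Γ g
    exact ⟨_, w, hw, rfl⟩
  obtain ⟨w, hw, hn⟩ := Nat.find_spec h
  exact ⟨w, fun w' hw' => hn ▸ Nat.find_min' h ⟨w', hw'.trans hw, rfl⟩, hw⟩

open Classical in
/-- The support of an element is contained in the set of letters of any word representing it. -/
theorem support_wordEval_subset {V : Type u} (Γ : SimpleGraph V) (w : List (V × Bool)) :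
    support Γ (wordEval Γ w) ⊆ {a | ∃ l ∈ w, l.1 = a} := by
  rintro _ ⟨w', hw', he, l, hl, rfl⟩
  by_contra hn
  have hcomm : ∀ b c, Γ.Adj b c →
      (if b = l.1 then 1 else of Γ b) * (if c = l.1 then 1 else of Γ c) =
        (if c = l.1 then 1 else of Γ c) * (if b = l.1 then 1 else of Γ b) := by
    intro b c h
    split_ifs <;> simp [of_comm Γ h]
  -- Killing the generator `l.1` deletes its letters: `w` is unchanged, while `w'` becomes a shorter
  -- word for the same element.
  have key : ∀ x : List (V × Bool),
      lift Γ (fun b => if b = l.1 then 1 else of Γ b) hcomm (wordEval Γ x) =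
        wordEval Γ (x.filter fun k => k.1 ≠ l.1) := by
    intro x
    induction x with
    | nil => simp [wordEval]
    | cons k x ih =>
      rw [wordEval_cons, map_mul, ih]
      obtain ⟨b, e⟩ := k
      by_cases hb : b = l.1
      · cases e <;> simp [hb]
      · cases e <;> simp [hb, wordEval]
  have hfw : w.filter (fun k => k.1 ≠ l.1) = w := by
    rw [List.filter_eq_self]
    intro k hk
    simpa using fun h => hn ⟨k, hk, h⟩
  have h1 : wordEval Γ (w'.filter fun k => k.1 ≠ l.1) = wordEval Γ w' := by
    rw [← key, he, key, hfw]
  have h2 := hw' _ h1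
  have h3 := List.length_filter_lt_length_iff_exists (l := w') (p := fun k => k.1 ≠ l.1)
  exact absurd (h3.2 ⟨l, hl, by simp⟩) (not_lt.2 h2)

theorem mem_support_of_mem {V : Type u} {Γ : SimpleGraph V} {w : List (V × Bool)}
    (hw : IsReducedWord Γ w) {l : V × Bool} (hl : l ∈ w) : l.1 ∈ support Γ (wordEval Γ w) :=
  ⟨w, hw, rfl, l, hl, rfl⟩

/-- The subgroup of the elements supported in a given set of vertices. -/
def supportedIn {V : Type u} (Γ : SimpleGraph V) (C : Set V) : Subgroup (RAAG Γ) where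
  carrier := {g | support Γ g ⊆ C}
  one_mem' := by
    intro a ha
    rw [← wordEval_nil] at ha
    simpa using support_wordEval_subset Γ [] ha
  mul_mem' := by
    intro g h hg hh a ha
    obtain ⟨w, hw, rfl⟩ := exists_isReducedWord Γ g
    obtain ⟨w', hw', rfl⟩ := exists_isReducedWord Γ h
    rw [← wordEval_append] at ha
    obtain ⟨l, hl, rfl⟩ := support_wordEval_subset Γ _ ha
    rcases List.mem_append.1 hl with hl | hl
    · exact hg (mem_support_of_mem hw hl)
    · exact hh (mem_support_of_mem hw' hl)
  inv_mem' := by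
    intro g hg a ha
    obtain ⟨w, hw, rfl⟩ := exists_isReducedWord Γ g
    obtain ⟨w', hw', h⟩ := exists_wordEval_inv Γ w
    rw [← hw'] at ha
    obtain ⟨l, hl, rfl⟩ := support_wordEval_subset Γ _ ha
    obtain ⟨k, hk, hkl⟩ := h l hl
    exact hkl ▸ hg (mem_support_of_mem hw hk)

theorem mem_supportedIn {V : Type u} {Γ : SimpleGraph V} {C : Set V} {g : RAAG Γ} :
    g ∈ supportedIn Γ C ↔ support Γ g ⊆ C := Iff.rfl

/-! ### Exponent sums of clique-supported elements -/

open Classical in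
theorem expSum_wordEval {V : Type u} (Γ : SimpleGraph V) (a : V) (w : List (V × Bool)) :
    expSum Γ a (wordEval Γ w) =
      Multiplicative.ofAdd ((w.count (a, true) : ℤ) - w.count (a, false)) := by
  induction w with
  | nil => simp [wordEval_nil]
  | cons k w ih =>
    rw [wordEval_cons, map_mul, ih]
    obtain ⟨b, e⟩ := k
    by_cases hb : b = a
    · subst hb
      cases e
      · simp only [cond_false, map_inv, expSum_of_self, ← ofAdd_neg, ← ofAdd_add]
        congr 1
        simp
        ring
      · simp only [cond_true, expSum_of_self, ← ofAdd_add]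
        congr 1
        simp
        ring
    · cases e <;> simp [expSum_of_ne Γ hb, hb]

/-- The letters of a reduced word for `g` commute, so a letter and its inverse would cancel: all
occurrences of `a` have the same sign. -/
theorem expSum_ne_one {V : Type u} {Γ : SimpleGraph V} {g : RAAG Γ}
    (hg : Γ.IsClique (support Γ g)) {a : V} (ha : a ∈ support Γ g) : expSum Γ a g ≠ 1 := by
  classical
  obtain ⟨w, hw, rfl, l, hl, rfl⟩ := ha
  intro h
  rw [expSum_wordEval, ofAdd_eq_one, sub_eq_zero, Nat.cast_inj] at h
  have hpos : 0 < w.count (l.1, true) ∧ 0 < w.count (l.1, false) := by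
    obtain ⟨b, e⟩ := l
    have := List.count_pos_iff.2 hl
    cases e <;> simp only at h ⊢ <;> omega
  have h1 : (l.1, true) ∈ w := List.count_pos_iff.1 hpos.1
  have h2 : (l.1, false) ∈ w.erase (l.1, true) :=
    (List.mem_erase_of_ne (by simp)).2 (List.count_pos_iff.1 hpos.2)
  have hp : w.Perm ((l.1, true) :: (l.1, false) :: (w.erase (l.1, true)).erase (l.1, false)) :=
    (List.perm_cons_erase h1).trans ((List.perm_cons_erase h2).cons _)
  have hc : ∀ x ∈ w, ∀ y ∈ w, Commute (of Γ x.1) (of Γ y.1) := by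
    intro x hx y hy
    by_cases hxy : x.1 = y.1
    · rw [hxy]
    · exact of_comm Γ (hg (mem_support_of_mem hw hx) (mem_support_of_mem hw hy) hxy)
  have he : wordEval Γ w = wordEval Γ ((w.erase (l.1, true)).erase (l.1, false)) := by
    have := (hp.map fun l => cond l.2 (of Γ l.1) (of Γ l.1)⁻¹).prod_eq' (by
      rw [List.pairwise_map]
      refine List.Pairwise.imp_of_mem (R := fun _ _ => True) ?_ (List.pairwise_of_forall (by simp))
      intro x y hx hy _
      have := hc x hx y hy
      cases x.2 <;> cases y.2 <;> simpa)
    change wordEval Γ w = wordEval Γ _ at this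
    rw [this, wordEval_cons, wordEval_cons]
    simp
  have h3 := hw _ he.symm
  have h4 := hp.length_eq
  simp only [List.length_cons] at h4
  omega

theorem eq_one_of_expSum_eq_one {V : Type u} {Γ : SimpleGraph V} {g : RAAG Γ}
    (hg : Γ.IsClique (support Γ g)) (h : ∀ a ∈ support Γ g, expSum Γ a g = 1) : g = 1 := by
  obtain ⟨w, hw, rfl⟩ := exists_isReducedWord Γ g
  cases w with
  | nil => exact wordEval_nil Γ
  | cons l w =>
    have hl := mem_support_of_mem hw (List.mem_cons_self (a := l) (l := w))
    exact absurd (h _ hl) (expSum_ne_one hg hl)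

/-- A homomorphism that kills all vertices of the support except possibly `a` factors through the
exponent sum of `a`. -/
theorem map_eq_zpow_expSum {V : Type u} {Γ : SimpleGraph V} {G : Type*} [Group G]
    (φ : RAAG Γ →* G) {a : V} {g : RAAG Γ}
    (h : ∀ b ∈ support Γ g, b ≠ a → φ (of Γ b) = 1) :
    φ g = φ (of Γ a) ^ (expSum Γ a g).toAdd := by
  obtain ⟨w, hw, rfl⟩ := exists_isReducedWord Γ g
  replace h : ∀ l ∈ w, l.1 ≠ a → φ (of Γ l.1) = 1 := fun l hl => h _ (mem_support_of_mem hw hl)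
  clear hw
  induction w with
  | nil => simp [wordEval_nil]
  | cons k w ih =>
    rw [wordEval_cons, map_mul, map_mul, ih fun l hl => h l (List.mem_cons_of_mem _ hl),
      toAdd_mul, zpow_add]
    congr 1
    have hk := h k List.mem_cons_self
    by_cases hka : k.1 = a
    · rw [hka]
      cases k.2 <;> simp [expSum_of_self]
    · cases k.2 <;> simp [expSum_of_ne Γ hka, hk hka]

/-! ### Commuting clique-supported elements -/

/-- Powers of the two standard transvections of `SL(2, ℤ)` do not commute. -/
theorem eq_zero_or_eq_zero_of_commute_transvections {n k : ℤ}
    (h : Commute (ModularGroup.T ^ n) ((ModularGroup.S * ModularGroup.T * ModularGroup.S⁻¹) ^ k)) :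
    n = 0 ∨ k = 0 := by
  rw [conj_zpow] at h
  -- The upper left entries of the two products are `1 - n * k` and `1`.
  have h1 := congrFun (congrFun (congrArg Subtype.val h.eq) 0) 0
  simp only [Matrix.SpecialLinearGroup.coe_mul, ModularGroup.coe_T_zpow, ModularGroup.coe_S,
    Matrix.SpecialLinearGroup.coe_inv, Matrix.adjugate_fin_two_of] at h1
  simp at h1
  tauto

/-- If two commuting elements are supported on cliques, then any vertex of the first support is
equal or adjacent to any vertex of the second. -/
theorem eq_or_adj_of_commute {V : Type u} {Γ : SimpleGraph V} {g h : RAAG Γ}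
    (hg : Γ.IsClique (support Γ g)) (hh : Γ.IsClique (support Γ h)) (hc : Commute g h)
    {a b : V} (ha : a ∈ support Γ g) (hb : b ∈ support Γ h) : a = b ∨ Γ.Adj a b := by
  classical
  by_contra! hab
  obtain ⟨hne, hadj⟩ := hab
  let f : V → Matrix.SpecialLinearGroup (Fin 2) ℤ := fun c =>
    if c = a then ModularGroup.T
    else if c = b then ModularGroup.S * ModularGroup.T * ModularGroup.S⁻¹ else 1
  have hf : ∀ c d, Γ.Adj c d → f c * f d = f d * f c := by
    intro c d hcd
    simp only [f]
    split_ifs with h1 h2 h3 h4 h5 h6 <;> subst_vars <;>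
      first | rfl | simp | exact absurd hcd hadj | exact absurd hcd.symm hadj
  let φ := lift Γ f hf
  have hφ : ∀ c, c ≠ a → c ≠ b → φ (of Γ c) = 1 := by
    intro c h1 h2
    simp [φ, f, h1, h2]
  -- The clique containing `a` cannot contain `b`, so `φ g` is a power of `T`, with nonzero exponent
  -- by `expSum_ne_one`.
  have hga : φ g = φ (of Γ a) ^ (expSum Γ a g).toAdd := by
    refine map_eq_zpow_expSum φ fun c hcg hca => hφ c hca ?_
    rintro rfl
    exact hadj (hg ha hcg hne)
  have hhb : φ h = φ (of Γ b) ^ (expSum Γ b h).toAdd := by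
    refine map_eq_zpow_expSum φ fun c hch hcb => hφ c ?_ hcb
    rintro rfl
    exact hadj (hh hch hb hne)
  have hcomm : Commute (φ g) (φ h) := hc.map φ
  have hfa : φ (of Γ a) = ModularGroup.T := by simp [φ, f]
  have hfb : φ (of Γ b) = ModularGroup.S * ModularGroup.T * ModularGroup.S⁻¹ := by
    simp [φ, f, hne.symm]
  rw [hga, hhb, hfa, hfb] at hcomm
  rcases eq_zero_or_eq_zero_of_commute_transvections hcomm with h0 | h0
  · exact expSum_ne_one hg ha (toAdd_eq_zero.1 h0)
  · exact expSum_ne_one hh hb (toAdd_eq_zero.1 h0)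

/-! ### The rank bound -/

/-- If an injective homomorphism sends distinct vertices `x i` to elements supported in a finite
clique, then there are at most as many of them as there are vertices in the clique. -/
theorem card_le_of_support_subset_clique {V : Type u} {W : Type v} {Λ : SimpleGraph V}
    {Γ : SimpleGraph W} (ψ : RAAG Λ →* RAAG Γ) (hψ : Function.Injective ψ) {C : Set W} [Fintype C]
    (hC : Γ.IsClique C) {I : Type*} [Fintype I] (x : I → V) (hx : Function.Injective x)
    (hxC : ∀ i, support Γ (ψ (of Λ (x i))) ⊆ C) : Fintype.card I ≤ Fintype.card C := by
  classical
  have hli : LinearIndependent ℤ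
      (fun (i : I) (c : C) => (expSum Γ c.1 (ψ (of Λ (x i)))).toAdd) := by
    rw [Fintype.linearIndependent_iff]
    intro n hn j
    -- A relation `n` among the exponent vectors makes all exponent sums of `ψ g` vanish, so `g =
    -- 1`; yet `x j` has exponent sum `n j` in `g`. The order of the factors is irrelevant to
    -- exponent sums.
    let g : RAAG Λ := (Finset.univ.toList.map fun i => of Λ (x i) ^ n i).prod
    have hmap : ∀ θ : RAAG Λ →* Multiplicative ℤ,
        θ g = ∏ i, θ (of Λ (x i)) ^ n i := by
      intro θ
      simp only [g, map_list_prod, List.map_map]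
      rw [← Finset.prod_map_toList]
      congr 1
      exact List.map_congr_left fun i _ => by simp
    have hgC : support Γ (ψ g) ⊆ C := by
      rw [← mem_supportedIn]
      simp only [g, map_list_prod, List.map_map]
      refine Subgroup.list_prod_mem _ fun y hy => ?_
      obtain ⟨i, -, rfl⟩ := List.mem_map.1 hy
      simp only [Function.comp, map_zpow]
      exact Subgroup.zpow_mem _ (mem_supportedIn.2 (hxC i)) _
    have hg1 : ψ g = 1 := by
      refine eq_one_of_expSum_eq_one (hC.subset hgC) fun c hc => ?_
      have h1 := hmap ((expSum Γ c).comp ψ)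
      simp only [MonoidHom.comp_apply] at h1
      rw [h1]
      have h2 := congrFun hn ⟨c, hgC hc⟩
      apply Multiplicative.toAdd.injective
      simpa [toAdd_prod] using h2
    have hg : g = 1 := hψ (hg1.trans (map_one ψ).symm)
    have h3 := hmap (expSum Λ (x j))
    rw [hg, map_one, Finset.prod_eq_single j] at h3
    · rw [expSum_of_self] at h3
      simpa using (congrArg Multiplicative.toAdd h3).symm
    · intro i _ hij
      rw [expSum_of_ne Λ (hx.ne hij), one_zpow]
    · simp
  simpa using hli.fintype_card_le_finrank

end RAAG

/-! ### Irreducible factors and the embedding of the join -/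

/-- An irreducible graph with at least two vertices has no cone vertex. -/
theorem IsJoinIrreducible.exists_not_adj {V : Type u} [Nontrivial V] {Λ : SimpleGraph V}
    (h : IsJoinIrreducible Λ) (a : V) : ∃ b, b ≠ a ∧ ¬ Λ.Adj a b := by
  classical
  by_contra! hcon
  -- The subtype is `{a}` for `k = 0` and its complement for `k = 1`.
  refine h ⟨fun k => {x : V // x = a ↔ k = 0}, fun k => Λ.comap Subtype.val, ?_, ⟨?_⟩⟩
  · intro k
    obtain ⟨b, hb⟩ := exists_ne a
    by_cases hk : k = 0
    · exact ⟨⟨a, by simp [hk]⟩⟩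
    · exact ⟨⟨b, by simp [hk, hb]⟩⟩
  · let e : V ≃ Σ k : Fin 2, {x : V // x = a ↔ k = 0} :=
      { toFun := fun x => ⟨if x = a then 0 else 1, x, by split_ifs <;> simp_all⟩
        invFun := fun y => y.2.1
        left_inv := fun x => rfl
        right_inv := by
          rintro ⟨k, x, hx⟩
          have hk : (if x = a then (0 : Fin 2) else 1) = k := by
            split_ifs with h0
            · exact (hx.1 h0).symm
            · have := mt hx.2 h0
              omega
          subst hk
          rfl }
    refine ⟨e, ?_⟩
    intro x y
    constructor
    · rintro (hxy | ⟨i, c, d, hcd, h1, h2⟩)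
      · by_cases hx : x = a
        · by_cases hy : y = a
          · simp [e, hx, hy] at hxy
          · exact hx ▸ hcon y hy
        · by_cases hy : y = a
          · exact hy ▸ (hcon x hx).symm
          · simp [e, hx, hy] at hxy
      · have h3 : x = c.1 := congrArg (fun z => e.symm z) h1
        have h4 : y = d.1 := congrArg (fun z => e.symm z) h2
        rw [h3, h4]
        exact hcd
    · intro hxy
      by_cases hk : (e x).1 = (e y).1
      · refine Or.inr ⟨(e y).1, ⟨x, hk ▸ (e x).2.2⟩, (e y).2, hxy, ?_, rfl⟩
        refine Sigma.subtype_ext hk rfl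
      · exact Or.inl hk

theorem proposition3p2 {m : ℕ} {V : Fin m → Type u} [∀ i, Finite (V i)]
    (Λ : ∀ i, SimpleGraph (V i)) (hΛ : ∀ i, IsJoinIrreducible (Λ i))
    {W : Type v} [Finite W] (Γ : SimpleGraph W)
    (ψ : RAAG (graphJoin Λ) →* RAAG Γ) (hψ : Function.Injective ψ)
    (hKK : RAAG.KKCondition ψ)
    (hι : ∀ i, ∃ ι : Λ i ↪g Γ,
      Set.range ι ⊆ RAAG.homSupport (ψ.comp (RAAG.map (graphJoinIncl Λ i).toHom))) :
    ∃ ι : graphJoin Λ ↪g Γ, Set.range ι ⊆ RAAG.homSupport ψ := by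
  classical
  choose ι hι using hι
  have hmem : ∀ i a, ∃ b : V i, ι i a ∈ RAAG.support Γ (ψ (RAAG.of _ ⟨i, b⟩)) := by
    intro i a
    obtain ⟨b, hb⟩ := Set.mem_iUnion.1 (hι i ⟨a, rfl⟩)
    refine ⟨b, ?_⟩
    simpa [RAAG.map, graphJoinIncl] using hb
  have hcross : ∀ x y : Σ i, V i, x.1 ≠ y.1 → ∀ s ∈ RAAG.support Γ (ψ (RAAG.of _ x)),
      ∀ t ∈ RAAG.support Γ (ψ (RAAG.of _ y)), s = t ∨ Γ.Adj s t := by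
    intro x y hxy s hs t ht
    refine RAAG.eq_or_adj_of_commute (hKK x) (hKK y) ?_ hs ht
    have hadj : (graphJoin Λ).Adj x y := Or.inl hxy
    exact (show Commute _ _ from RAAG.of_comm _ hadj).map ψ
  -- the cone vertices of the subgraph induced on the support
  let C : Set W := {c | c ∈ RAAG.homSupport ψ ∧ ∀ s ∈ RAAG.homSupport ψ, c = s ∨ Γ.Adj c s}
  have hC : Γ.IsClique C := fun c hc d hd hcd => (hc.2 d hd.1).resolve_left hcd
  have hS : ∀ x, RAAG.support Γ (ψ (RAAG.of _ x)) ⊆ RAAG.homSupport ψ :=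
    fun x => Set.subset_iUnion (fun a => RAAG.support Γ (ψ (RAAG.of (graphJoin Λ) a))) x
  have hsingle : ∀ x : Σ i, V i, Subsingleton (V x.1) →
      RAAG.support Γ (ψ (RAAG.of _ x)) ⊆ C := by
    intro x hx s hs
    refine ⟨hS x hs, fun t ht => ?_⟩
    obtain ⟨y, hy⟩ := Set.mem_iUnion.1 ht
    by_cases hxy : x.1 = y.1
    · obtain ⟨i, a⟩ := x
      obtain ⟨j, b⟩ := y
      obtain rfl : i = j := hxy
      obtain rfl : a = b := Subsingleton.elim (α := V i) a b
      by_cases hst : s = t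
      · exact Or.inl hst
      · exact Or.inr (hKK _ hs hy hst)
    · exact hcross x y hxy s hs t hy
  have hcommon : ∀ x y : Σ i, V i, x.1 ≠ y.1 → ∀ s ∈ RAAG.support Γ (ψ (RAAG.of _ x)),
      s ∈ RAAG.support Γ (ψ (RAAG.of _ y)) → s ∈ C := by
    intro x y hxy s hs hs'
    refine ⟨hS x hs, fun t ht => ?_⟩
    -- The factor of `z` differs from that of `x` or from that of `y`, and `s` lies in both
    -- supports.
    obtain ⟨z, hz⟩ := Set.mem_iUnion.1 ht
    by_cases hxz : x.1 = z.1
    · exact hcross y z (hxz ▸ hxy.symm) s hs' t hz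
    · exact hcross x z hxz s hs t hz
  have hnotC : ∀ i (a : V i), ¬ Subsingleton (V i) → ι i a ∉ C := by
    intro i a hi ha
    have := not_subsingleton_iff_nontrivial.1 hi
    obtain ⟨b, hba, hab⟩ := (hΛ i).exists_not_adj a
    obtain ⟨b', hb'⟩ := hmem i b
    rcases ha.2 _ (hS _ hb') with h | h
    · exact hba ((ι i).injective h).symm
    · exact hab ((ι i).map_adj_iff.1 h)
  -- The empty graph counts as irreducible here; empty factors must not be counted.
  let I := {i : Fin m // Subsingleton (V i) ∧ Nonempty (V i)}
  have : Fintype C := Fintype.ofFinite C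
  have hcard : Fintype.card I ≤ Fintype.card C :=
    RAAG.card_le_of_support_subset_clique ψ hψ hC
      (fun i : I => (⟨i.1, i.2.2.some⟩ : Σ i, V i))
      (fun i j hij => Subtype.ext (congrArg Sigma.fst hij))
      (fun i => hsingle _ i.2.1)
  obtain ⟨f⟩ := Function.Embedding.nonempty_of_card_le hcard
  let F : (Σ i, V i) → W := fun x =>
    if h : Subsingleton (V x.1) then (f ⟨x.1, h, ⟨x.2⟩⟩).1 else ι x.1 x.2
  have hF1 : ∀ x (h : Subsingleton (V x.1)), F x = (f ⟨x.1, h, ⟨x.2⟩⟩).1 := fun x h => dif_pos h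
  have hF2 : ∀ x, ¬ Subsingleton (V x.1) → F x = ι x.1 x.2 := fun x h => dif_neg h
  have hFC : ∀ x, Subsingleton (V x.1) → F x ∈ C := fun x h => hF1 x h ▸ (f _).2
  have hFS : ∀ x, F x ∈ RAAG.homSupport ψ := by
    intro x
    by_cases h : Subsingleton (V x.1)
    · exact (hFC x h).1
    · obtain ⟨b, hb⟩ := hmem x.1 x.2
      exact hF2 x h ▸ hS _ hb
  have hFadj : ∀ x y, x.1 ≠ y.1 → Γ.Adj (F x) (F y) := by
    intro x y hxy
    by_cases hx : Subsingleton (V x.1)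
    · refine ((hFC x hx).2 _ (hFS y)).resolve_left fun h => ?_
      by_cases hy : Subsingleton (V y.1)
      · rw [hF1 x hx, hF1 y hy] at h
        exact hxy (congrArg Subtype.val (f.injective (Subtype.ext h)))
      · exact hnotC y.1 y.2 hy (hF2 y hy ▸ h ▸ hFC x hx)
    · by_cases hy : Subsingleton (V y.1)
      · refine (((hFC y hy).2 _ (hFS x)).resolve_left fun h => ?_).symm
        exact hnotC x.1 x.2 hx (hF2 x hx ▸ h ▸ hFC y hy)
      · rw [hF2 x hx, hF2 y hy]
        obtain ⟨b, hb⟩ := hmem x.1 x.2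
        obtain ⟨c, hc⟩ := hmem y.1 y.2
        -- If the two images were equal, they would be a common support vertex of two factors, hence
        -- in `C`.
        refine (hcross ⟨x.1, b⟩ ⟨y.1, c⟩ hxy _ hb _ hc).resolve_left fun h => ?_
        exact hnotC x.1 x.2 hx (hcommon ⟨x.1, b⟩ ⟨y.1, c⟩ hxy _ hb (h ▸ hc))
  have hFinj : Function.Injective F := by
    intro x y hxy
    by_cases hne : x.1 = y.1
    · obtain ⟨i, a⟩ := x
      obtain ⟨j, b⟩ := y
      obtain rfl : i = j := hne
      by_cases hi : Subsingleton (V i)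
      · rw [Subsingleton.elim (α := V i) a b]
      · rw [hF2 _ hi, hF2 _ hi] at hxy
        exact congrArg _ ((ι i).injective hxy)
    · exact absurd hxy (hFadj x y hne).ne
  refine ⟨⟨⟨F, hFinj⟩, ?_⟩, ?_⟩
  · intro x y
    by_cases hne : x.1 = y.1
    · obtain ⟨i, a⟩ := x
      obtain ⟨j, b⟩ := y
      obtain rfl : i = j := hne
      have hjoin : (graphJoin Λ).Adj ⟨i, a⟩ ⟨i, b⟩ ↔ (Λ i).Adj a b :=
        (graphJoinIncl Λ i).map_adj_iff (v := a) (w := b)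
      rw [hjoin]
      change Γ.Adj (F _) (F _) ↔ _
      by_cases hi : Subsingleton (V i)
      · rw [Subsingleton.elim (α := V i) a b]
        simp
      · rw [hF2 _ hi, hF2 _ hi]
        exact (ι i).map_adj_iff
    · exact iff_of_true (hFadj x y hne) (Or.inl hne)
  · rintro _ ⟨x, rfl⟩
    exact hFS x
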